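/- Let $\mathcal A$ be a hereditary abelian category, i.e. an abelian category with $\mathrm{Ext}^i(X,Y)=0$ for all objects $X,Y$ and all $i>1$. A 3-cycle complex over $\mathcal A$ is a complex indexed by $\mathbb Z/3$, written $X_1\xrightarrow{f_1}X_2\xrightarrow{f_2}X_3\xrightarrow{f_3}X_1$, where the composite of any two consecutive maps is zero; morphisms are families of maps commuting with the differentials. Let $\mathcal D_3(\mathcal A)$ be the relative derived category, obtained from the category of 3-cycle complexes modulo ($\mathbb Z/3$-periodic) chain homotopy by inverting the quasi-isomorphisms. Its translation functor $[1]$ is induced by $(X[1])_i=X_{i+1}$, $d_{X[1]}=-d_X$. An object $M$ of $\mathcal A$ is viewed in $\mathcal D_3(\mathcal A)$ as the complex with $M$ in position $1$ and $0$ in positions $2$ and $3$. Let $\dot X: X_1\xrightarrow{f_1}X_2\xrightarrow{f_2}X_3\xrightarrow{f_3}X_1$ be a 3-cycle complex over $\mathcal A$, and let $f:\mathrm{Coker} f_2\to\mathrm{Ker} f_1$ be the map induced by $f_3$, i.e. the unique map whose composite $X_3\to\mathrm{Coker} f_2\xrightarrow{f}\mathrm{Ker} f_1\to X_1$ with the canonical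 maps is $f_3$. Then in $\mathcal D_3(\mathcal A)$ the object $\dot X$ is isomorphic to the 3-cycle complex $$\mathrm{Ker} f_1\xrightarrow{\ 0\ }\mathrm{Ker} f_2/\mathrm{Im} f_1\xrightarrow{\ 0\ }\mathrm{Coker} f_2\xrightarrow{\ f\ }\mathrm{Ker} f_1,$$ and, consequently, to the direct sum $$(\mathrm{Ker} f_2/\mathrm{Im} f_1)[2]\ \oplus\ (\mathrm{Ker} f)[1]\ \oplus\ \mathrm{Coker} f .$$ -/

import Mathlib

open CategoryTheory CategoryTheory.Limits

universe v u

/-- A hereditary abelian category: `Ext^i(X, Y) = 0` for all objects `X`, `Y` and all `i > 1`.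
(`HasExt.standard` is the canonical choice of universe for the `Ext`-groups, which always
exists, so that nothing is assumed about their size.) -/
class IsHereditary (A : Type u) [Category.{v} A] [Abelian A] : Prop where
  ext_eq_zero : letI := HasExt.standard A
    ∀ (X Y : A) (i : ℕ), 1 < i → ∀ e : Abelian.Ext.{max u v} X Y i, e = 0

noncomputable section

variable (A : Type u) [Category.{v} A] [Abelian A] (t : ℕ)

/-- The abelian category `C_t(A)` of `t`-cycle complexes: complexes in `A` indexed by `ℤ/t`, with
differentials `X i ⟶ X (i + 1)`.  Morphisms are families of maps commuting with the
differentials. -/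
abbrev CycleComplex := HomologicalComplex A (ComplexShape.up (ZMod t))

/-- The relative homotopy category `K_t(A)`: `t`-cycle complexes, and morphisms modulo the
relative homotopies `s i : X i ⟶ Y (i - 1)`. -/
abbrev CycleHomotopyCategory := HomotopyCategory A (ComplexShape.up (ZMod t))

/-- The functor `C_t(A) ⥤ K_t(A)`. -/
abbrev CycleHomotopyCategory.quotient : CycleComplex A t ⥤ CycleHomotopyCategory A t :=
  HomotopyCategory.quotient A (ComplexShape.up (ZMod t))

/-- The quasi-isomorphisms in `K_t(A)`: the morphisms that induce isomorphisms on all the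
homology objects. -/
abbrev CycleHomotopyCategory.quasiIso : MorphismProperty (CycleHomotopyCategory A t) :=
  HomotopyCategory.quasiIso A (ComplexShape.up (ZMod t))

/-- The relative derived category `D_t(A)`: the localization of `K_t(A)` with respect to the
quasi-isomorphisms. -/
abbrev CycleDerivedCategory := (CycleHomotopyCategory.quasiIso A t).Localization

/-- The localization functor `K_t(A) ⥤ D_t(A)`. -/
abbrev CycleDerivedCategory.Qh : CycleHomotopyCategory A t ⥤ CycleDerivedCategory A t :=
  (CycleHomotopyCategory.quasiIso A t).Q

/-- The canonical functor `C_t(A) ⥤ D_t(A)`. -/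
abbrev CycleDerivedCategory.Q : CycleComplex A t ⥤ CycleDerivedCategory A t :=
  CycleHomotopyCategory.quotient A t ⋙ CycleDerivedCategory.Qh A t

end

/-! ### The translation functor -/

noncomputable section

variable (A : Type u) [Category.{v} A] [Abelian A] (t : ℕ)

/-- The translation functor `[1]` of `C_t(A)`: `X[1] i = X (i + 1)`, with differential `-d`. -/
def CycleComplex.shift : CycleComplex A t ⥤ CycleComplex A t where
  obj X :=
    { X := fun i => X.X (i + 1)
      d := fun i j => -X.d (i + 1) (j + 1)
      shape := fun i j hij => by
        rw [X.shape, neg_zero]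
        intro h
        exact hij (add_right_cancel (show i + 1 + 1 = j + 1 from h))
      d_comp_d' := fun i j k _ _ => by simp }
  map φ :=
    { f := fun i => φ.f (i + 1)
      comm' := fun i j _ => by simp }

/-- The translate of a family of maps `X i ⟶ Y j`, with a sign. -/
def CycleComplex.shiftHom {X Y : CycleComplex A t} (h : ∀ i j, X.X i ⟶ Y.X j) (i j : ZMod t) :
    ((CycleComplex.shift A t).obj X).X i ⟶ ((CycleComplex.shift A t).obj Y).X j :=
  -h (i + 1) (j + 1)

/-- The translate of a relative homotopy. -/
def CycleComplex.shiftHomotopy {X Y : CycleComplex A t} {φ ψ : X ⟶ Y} (h : Homotopy φ ψ) :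
    Homotopy ((CycleComplex.shift A t).map φ) ((CycleComplex.shift A t).map ψ) where
  hom := CycleComplex.shiftHom A t h.hom
  zero i j hij := neg_eq_zero.2 (h.zero _ _ fun h' =>
    hij (add_right_cancel (show j + 1 + 1 = i + 1 from h')))
  comm i := by
    have h₁ : (ComplexShape.up (ZMod t)).Rel i (i + 1) := rfl
    have h₂ : (ComplexShape.up (ZMod t)).Rel (i - 1) i := sub_add_cancel i 1
    have h₃ : (ComplexShape.up (ZMod t)).Rel (i + 1) (i + 1 + 1) := rfl
    have h₄ : (ComplexShape.up (ZMod t)).Rel (i - 1 + 1) (i + 1) := by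
      rw [sub_add_cancel]; rfl
    have h₅ := h.comm (i + 1)
    rw [dNext_eq _ h₃, prevD_eq _ h₄] at h₅
    rw [dNext_eq _ h₁, prevD_eq _ h₂]
    refine h₅.trans ?_
    congr 2
    · exact (Preadditive.neg_comp_neg _ _).symm
    · exact (Preadditive.neg_comp_neg _ _).symm

/-- The translation functor `[1]` of `K_t(A)`. -/
def CycleHomotopyCategory.shift : CycleHomotopyCategory A t ⥤ CycleHomotopyCategory A t :=
  CategoryTheory.Quotient.lift _ (CycleComplex.shift A t ⋙ CycleHomotopyCategory.quotient A t)
    (fun _ _ _ _ ⟨h⟩ => HomotopyCategory.eq_of_homotopy _ _ (CycleComplex.shiftHomotopy A t h))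

/-- Up to signs, the short complex of `X[1]` at `i` is that of `X` at `i + 1`. -/
def CycleComplex.fromShift (X : CycleComplex A t) (i : ZMod t) :
    ((CycleComplex.shift A t).obj X).sc' (i - 1) i (i + 1) ⟶
      X.sc' (i - 1 + 1) (i + 1) (i + 1 + 1) where
  τ₁ := -𝟙 (X.X (i - 1 + 1))
  τ₂ := 𝟙 (X.X (i + 1))
  τ₃ := -𝟙 (X.X (i + 1 + 1))
  comm₁₂ := by
    change (-𝟙 _) ≫ X.d _ _ = (-X.d _ _) ≫ 𝟙 _
    rw [Preadditive.neg_comp, Category.id_comp, Category.comp_id]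
  comm₂₃ := by
    change 𝟙 _ ≫ X.d _ _ = (-X.d _ _) ≫ (-𝟙 _)
    rw [Preadditive.neg_comp_neg, Category.id_comp, Category.comp_id]

/-- The inverse of `CycleComplex.fromShift`. -/
def CycleComplex.toShift (X : CycleComplex A t) (i : ZMod t) :
    X.sc' (i - 1 + 1) (i + 1) (i + 1 + 1) ⟶
      ((CycleComplex.shift A t).obj X).sc' (i - 1) i (i + 1) where
  τ₁ := -𝟙 (X.X (i - 1 + 1))
  τ₂ := 𝟙 (X.X (i + 1))
  τ₃ := -𝟙 (X.X (i + 1 + 1))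
  comm₁₂ := by
    change (-𝟙 _) ≫ (-X.d _ _) = X.d _ _ ≫ 𝟙 _
    rw [Preadditive.neg_comp_neg, Category.id_comp, Category.comp_id]
  comm₂₃ := by
    change 𝟙 _ ≫ (-X.d _ _) = X.d _ _ ≫ (-𝟙 _)
    exact (Category.id_comp _).trans
      ((Preadditive.comp_neg _ _).trans (congrArg _ (Category.comp_id _))).symm

theorem CycleComplex.isIso_fromShift (X : CycleComplex A t) (i : ZMod t) :
    IsIso (CycleComplex.fromShift A t X i) := by
  refine ⟨CycleComplex.toShift A t X i, ?_, ?_⟩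
  · refine ShortComplex.hom_ext _ _ ?_ ?_ ?_
    · exact (Preadditive.neg_comp_neg _ _).trans (Category.comp_id _)
    · exact Category.comp_id _
    · exact (Preadditive.neg_comp_neg _ _).trans (Category.comp_id _)
  · refine ShortComplex.hom_ext _ _ ?_ ?_ ?_
    · exact (Preadditive.neg_comp_neg _ _).trans (Category.comp_id _)
    · exact Category.comp_id _
    · exact (Preadditive.neg_comp_neg _ _).trans (Category.comp_id _)

theorem CycleComplex.quasiIso_shift_map {X Y : CycleComplex A t} (φ : X ⟶ Y) [QuasiIso φ] :
    QuasiIso ((CycleComplex.shift A t).map φ) where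
  quasiIsoAt i := by
    have h₁ : (ComplexShape.up (ZMod t)).prev i = i - 1 :=
      ComplexShape.prev_eq' _ (sub_add_cancel i 1)
    have h₂ : (ComplexShape.up (ZMod t)).next i = i + 1 := ComplexShape.next_eq' _ rfl
    have h₃ : (ComplexShape.up (ZMod t)).prev (i + 1) = i - 1 + 1 :=
      ComplexShape.prev_eq' _ (by rw [sub_add_cancel]; rfl)
    have h₄ : (ComplexShape.up (ZMod t)).next (i + 1) = i + 1 + 1 :=
      ComplexShape.next_eq' _ rfl
    rw [quasiIsoAt_iff' _ _ i _ h₁ h₂]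
    have : ShortComplex.QuasiIso ((HomologicalComplex.shortComplexFunctor' A
        (ComplexShape.up (ZMod t)) (i - 1 + 1) (i + 1) (i + 1 + 1)).map φ) :=
      (quasiIsoAt_iff' φ _ (i + 1) _ h₃ h₄).1 inferInstance
    have := CycleComplex.isIso_fromShift A t X i
    have := CycleComplex.isIso_fromShift A t Y i
    have h : (HomologicalComplex.shortComplexFunctor' A (ComplexShape.up (ZMod t))
          (i - 1) i (i + 1)).map ((CycleComplex.shift A t).map φ) ≫
          CycleComplex.fromShift A t Y i =
        CycleComplex.fromShift A t X i ≫
          (HomologicalComplex.shortComplexFunctor' A (ComplexShape.up (ZMod t))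
            (i - 1 + 1) (i + 1) (i + 1 + 1)).map φ := by
      refine ShortComplex.hom_ext _ _ ?_ ?_ ?_
      · exact (Preadditive.comp_neg _ _).trans (((congrArg _ (Category.comp_id _)).trans
          (congrArg _ (Category.id_comp _).symm)).trans (Preadditive.neg_comp _ _).symm)
      · exact (Category.comp_id _).trans (Category.id_comp _).symm
      · exact (Preadditive.comp_neg _ _).trans (((congrArg _ (Category.comp_id _)).trans
          (congrArg _ (Category.id_comp _).symm)).trans (Preadditive.neg_comp _ _).symm)
    rw [← IsIso.eq_comp_inv] at h
    rw [h]
    infer_instance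

theorem CycleHomotopyCategory.shift_inverts :
    (CycleHomotopyCategory.quasiIso A t).IsInvertedBy
      (CycleHomotopyCategory.shift A t ⋙ CycleDerivedCategory.Qh A t) := by
  rintro ⟨X⟩ ⟨Y⟩ φ hφ
  obtain ⟨φ, rfl⟩ := (CycleHomotopyCategory.quotient A t).map_surjective φ
  have : QuasiIso φ := (HomotopyCategory.quotient_map_mem_quasiIso_iff φ).1 hφ
  have h : QuasiIso ((CycleComplex.shift A t).map φ) := CycleComplex.quasiIso_shift_map A t φ
  exact MorphismProperty.Q_inverts _ _
    ((HomotopyCategory.quotient_map_mem_quasiIso_iff ((CycleComplex.shift A t).map φ)).2 h)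

/-- The translation functor `[1]` of `D_t(A)`, induced by that of `K_t(A)`. -/
def CycleDerivedCategory.shift : CycleDerivedCategory A t ⥤ CycleDerivedCategory A t :=
  Localization.Construction.lift
    (CycleHomotopyCategory.shift A t ⋙ CycleDerivedCategory.Qh A t)
    (CycleHomotopyCategory.shift_inverts A t)

end

/-! ### Direct sums in the relative derived category -/

theorem isStableUnderFiniteProducts_of_additive {C : Type*} [Category* C] [Preadditive C]
    {D : Type*} [Category* D] [Preadditive D] [HasFiniteProducts C] [HasFiniteProducts D]
    {ι : Type*} (F : ι → C ⥤ D) [∀ i, (F i).Additive] (W : MorphismProperty C)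
    (hW : ∀ {X Y : C} (f : X ⟶ Y), W f ↔ ∀ i, IsIso ((F i).map f)) :
    W.IsStableUnderFiniteProducts where
  isStableUnderProductsOfShape J _ := by
    have : W.RespectsIso := by
      apply MorphismProperty.RespectsIso.of_respects_arrow_iso
      intro f g e hf
      refine (hW _).2 fun i => ?_
      exact ((MorphismProperty.isomorphisms D).arrow_mk_iso_iff
        ((F i).mapArrow.mapIso e)).1 ((hW _).1 hf i)
    refine MorphismProperty.IsStableUnderProductsOfShape.mk _ _ ?_
    intro X₁ X₂ _ _ f hf
    refine (hW _).2 fun i => ?_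
    have := fun j => (hW _).1 (hf j) i
    have : HasFiniteBiproducts C := HasFiniteBiproducts.of_hasFiniteProducts
    have h₁ : PreservesLimit (Discrete.functor X₁) (F i) := inferInstance
    have h₂ : PreservesLimit (Discrete.functor X₂) (F i) := inferInstance
    have : HasProduct fun j => (F i).obj (X₁ j) :=
      ⟨⟨_, isLimitFanMkObjOfIsLimit (F i) X₁ _ (productIsProduct X₁)⟩⟩
    have : HasProduct fun j => (F i).obj (X₂ j) :=
      ⟨⟨_, isLimitFanMkObjOfIsLimit (F i) X₂ _ (productIsProduct X₂)⟩⟩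
    have h : (F i).map (Limits.Pi.map f) ≫ piComparison (F i) X₂ =
        piComparison (F i) X₁ ≫ Limits.Pi.map fun j => (F i).map (f j) := by
      ext j
      simp [← Functor.map_comp]
    have : IsIso (Limits.Pi.map fun j => (F i).map (f j)) :=
      (Limits.Pi.mapIso fun j => asIso ((F i).map (f j))).isIso_hom
    have : IsIso ((F i).map (Limits.Pi.map f) ≫ piComparison (F i) X₂) := by
      rw [h]
      infer_instance
    exact IsIso.of_isIso_comp_right _ (piComparison (F i) X₂)

section DirectSums

variable (A : Type u) [Category.{v} A] [Abelian A] (t : ℕ)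

instance CycleHomotopyCategory.hasFiniteProducts :
    HasFiniteProducts (CycleHomotopyCategory A t) :=
  Functor.hasFiniteProducts_of_additive_of_essSurj (CycleHomotopyCategory.quotient A t)

instance CycleHomotopyCategory.quasiIso_isStableUnderFiniteProducts :
    (CycleHomotopyCategory.quasiIso A t).IsStableUnderFiniteProducts :=
  isStableUnderFiniteProducts_of_additive
    (HomotopyCategory.homologyFunctor A (ComplexShape.up (ZMod t))) _ (fun _ => Iff.rfl)

instance CycleHomotopyCategory.quasiIso_op_isStableUnderFiniteProducts :
    (CycleHomotopyCategory.quasiIso A t).op.IsStableUnderFiniteProducts :=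
  have : HasFiniteBiproducts (CycleHomotopyCategory A t) := .of_hasFiniteProducts
  isStableUnderFiniteProducts_of_additive
    (fun i => (HomotopyCategory.homologyFunctor A (ComplexShape.up (ZMod t)) i).op) _
    (fun _ => forall_congr' fun _ => (isIso_op_iff _).symm)

instance CycleDerivedCategory.preservesFiniteProducts_Qh :
    PreservesFiniteProducts (CycleDerivedCategory.Qh A t) :=
  Localization.preservesFiniteProducts _ (CycleHomotopyCategory.quasiIso A t)

instance CycleDerivedCategory.preservesFiniteCoproducts_Qh :
    PreservesFiniteCoproducts (CycleDerivedCategory.Qh A t) := by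
  have : HasFiniteBiproducts (CycleHomotopyCategory A t) := .of_hasFiniteProducts
  have : PreservesFiniteProducts (CycleDerivedCategory.Qh A t).op :=
    Localization.preservesFiniteProducts _ (CycleHomotopyCategory.quasiIso A t).op
  exact preservesFiniteCoproducts_unop (CycleDerivedCategory.Qh A t).op

theorem CycleDerivedCategory.isZero_Qh_obj {X : CycleHomotopyCategory A t} (hX : IsZero X) :
    IsZero ((CycleDerivedCategory.Qh A t).obj X) :=
  let h₁ := IsInitial.isInitialObj (CycleDerivedCategory.Qh A t) X hX.isInitial
  let h₂ := IsTerminal.isTerminalObj (CycleDerivedCategory.Qh A t) X hX.isTerminal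
  ⟨fun Y => ⟨⟨⟨h₁.to Y⟩, fun _ => h₁.hom_ext _ _⟩⟩,
    fun Y => ⟨⟨⟨h₂.from Y⟩, fun _ => h₂.hom_ext _ _⟩⟩⟩

instance : HasZeroObject (CycleDerivedCategory A t) :=
  ⟨_, CycleDerivedCategory.isZero_Qh_obj A t (isZero_zero _)⟩

/-- The zero morphisms of `D_t(A)`: those that factor through a zero object. -/
noncomputable instance : HasZeroMorphisms (CycleDerivedCategory A t) :=
  HasZeroObject.zeroMorphismsOfZeroObject

instance : (CycleDerivedCategory.Qh A t).PreservesZeroMorphisms :=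
  inferInstance

/-- Any two objects of `D_t(A)` have a direct sum. -/
instance : HasBinaryBiproducts (CycleDerivedCategory A t) where
  has_binary_biproduct X Y := by
    have : HasBinaryBiproducts (CycleHomotopyCategory A t) := .of_hasBinaryProducts
    let F := CycleDerivedCategory.Qh A t
    let x : CycleHomotopyCategory A t := X.as.obj
    let y : CycleHomotopyCategory A t := Y.as.obj
    change HasBinaryBiproduct (F.obj x) (F.obj y)
    exact HasBinaryBiproduct.mk
      { bicone := F.mapBinaryBicone (BinaryBiproduct.bicone x y)
        isBilimit :=
          { isLimit := mapIsLimitOfPreservesOfIsLimit F _ _ (BinaryBiproduct.isLimit x y)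
            isColimit := mapIsColimitOfPreservesOfIsColimit F _ _
              (BinaryBiproduct.isColimit x y) } }

end DirectSums

/-! ### Stalk complexes and the 3-cycle complex given by three maps -/

noncomputable section

variable {A : Type u} [Category.{v} A] [Abelian A]

/-- An object `M` of `A`, viewed in `D_3(A)` as the stalk complex `M ⟶ 0 ⟶ 0 ⟶ M` with `M` in
position `1`. Thus `M[1]` is `0 ⟶ 0 ⟶ M ⟶ 0` and `M[2]` is `0 ⟶ M ⟶ 0 ⟶ 0`. -/
def stalk (M : A) : CycleDerivedCategory A 3 :=
  (CycleDerivedCategory.Q A 3).obj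
    ((HomologicalComplex.single A (ComplexShape.up (ZMod 3)) 1).obj M)

/-- The terms of the 3-cycle complex `X₁ ⟶ X₂ ⟶ X₃ ⟶ X₁`; note that `0 = 3` in `ℤ/3`. -/
def threeCycleX (X₁ X₂ X₃ : A) : Fin 3 → A
  | 0 => X₃
  | 1 => X₁
  | 2 => X₂

/-- The differentials of the 3-cycle complex `X₁ ⟶ X₂ ⟶ X₃ ⟶ X₁`. -/
def threeCycleD {X₁ X₂ X₃ : A} (f₁ : X₁ ⟶ X₂) (f₂ : X₂ ⟶ X₃) (f₃ : X₃ ⟶ X₁) :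
    ∀ i j : Fin 3, threeCycleX X₁ X₂ X₃ i ⟶ threeCycleX X₁ X₂ X₃ j
  | 1, 2 => f₁
  | 2, 0 => f₂
  | 0, 1 => f₃
  | _, _ => 0

/-- The 3-cycle complex `X₁ ⟶ X₂ ⟶ X₃ ⟶ X₁` with maps `f₁`, `f₂`, `f₃`. -/
def threeCycle {X₁ X₂ X₃ : A} (f₁ : X₁ ⟶ X₂) (f₂ : X₂ ⟶ X₃) (f₃ : X₃ ⟶ X₁)
    (h₁₂ : f₁ ≫ f₂ = 0) (h₂₃ : f₂ ≫ f₃ = 0) (h₃₁ : f₃ ≫ f₁ = 0) : CycleComplex A 3 where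
  X := threeCycleX X₁ X₂ X₃
  d := threeCycleD f₁ f₂ f₃
  shape := by
    change ∀ i j : Fin 3, ¬ i + 1 = j → threeCycleD f₁ f₂ f₃ i j = 0
    intro i j hij
    fin_cases i <;> fin_cases j <;> first | rfl | exact absurd rfl hij
  d_comp_d' := by
    change ∀ i j k : Fin 3, i + 1 = j → j + 1 = k →
      threeCycleD f₁ f₂ f₃ i j ≫ threeCycleD f₁ f₂ f₃ j k = 0
    rintro i _ _ rfl rfl
    fin_cases i
    · exact h₃₁
    · exact h₁₂
    · exact h₂₃

/-- The quotient `Ker g / Im f` of two composable maps with zero composite. -/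
def kerModIm {X Y Z : A} (f : X ⟶ Y) (g : Y ⟶ Z) (h : f ≫ g = 0) : A :=
  cokernel (kernel.lift g (image.ι f) (by
    rw [← cancel_epi (factorThruImage f), image.fac_assoc, h, comp_zero]))

/-- The map `Coker f₂ ⟶ Ker f₁` induced by `f₃`: the unique one whose composite
`X₃ ⟶ Coker f₂ ⟶ Ker f₁ ⟶ X₁` is `f₃`. -/
def cokerToKer {X₁ X₂ X₃ : A} (f₁ : X₁ ⟶ X₂) (f₂ : X₂ ⟶ X₃) (f₃ : X₃ ⟶ X₁)
    (h₂₃ : f₂ ≫ f₃ = 0) (h₃₁ : f₃ ≫ f₁ = 0) : cokernel f₂ ⟶ kernel f₁ :=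
  cokernel.desc f₂ (kernel.lift f₁ f₃ h₃₁) (by
    rw [← cancel_mono (kernel.ι f₁), Category.assoc, kernel.lift_ι, h₂₃, zero_comp])

end

/-!
Over a hereditary category `Ext¹(W, Ker g) ⟶ Ext¹(Im g, Ker g)` is onto, as `Ext² = 0`. Hence every
map `g : X ⟶ W` factors as a monomorphism `u : X ⟶ E` followed by an epimorphism `p : E ⟶ W`
with `Ker p ≅ Ker g` and `Coker u ≅ Coker g`. For `g = f₁` this gives a complex
`X₁ ⊞ Ker f₁ ⟶ E ⟶ X₃ ⟶ X₁ ⊞ Ker f₁` with quasi-isomorphisms both to the given complex and to the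
one with `f₁` replaced by `0 : Ker f₁ ⟶ Coker f₁`. Up to rotation, the same replacement for the
second map yields the first isomorphism of the proposition, and then for the third map the second
one.
-/

section Extensions

open Abelian (Ext)
open DerivedCategory Pretriangulated

universe w

variable {A : Type u} [Category.{v} A] [Abelian A]

section

variable [HasDerivedCategory.{w} A]

theorem shortExact_of_distTriang_single (S : ShortComplex A)
    (h : (singleFunctor A 0).obj S.X₃ ⟶ ((singleFunctor A 0).obj S.X₁)⟦(1 : ℤ)⟧)
    (hT : Triangle.mk ((singleFunctor A 0).map S.f) ((singleFunctor A 0).map S.g) h ∈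
      distTriang (DerivedCategory A)) : S.ShortExact := by
  have e := singleFunctorCompHomologyFunctorIso A 0
  have hf : Mono S.f := by
    refine ((MorphismProperty.monomorphisms A).arrow_mk_iso_iff
      ((Functor.mapArrowFunctor _ _).mapIso e |>.app (Arrow.mk S.f))).1
      ((HomologySequence.mono_homologyMap_mor₁_iff _ hT (-1) 0 (by lia)).2 ?_)
    exact (isZero_of_isGE ((singleFunctor A 0).obj S.X₃) 0 (-1) (by lia)).eq_of_src _ _
  have hg : Epi S.g := by
    refine ((MorphismProperty.epimorphisms A).arrow_mk_iso_iff
      ((Functor.mapArrowFunctor _ _).mapIso e |>.app (Arrow.mk S.g))).1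
      ((HomologySequence.epi_homologyMap_mor₂_iff _ hT 0 1 (by lia)).2 ?_)
    exact (isZero_of_isLE ((singleFunctor A 0).obj S.X₁) 0 1 (by lia)).eq_of_tgt _ _
  exact ⟨(ShortComplex.exact_iff_of_iso (S.mapNatIso e)).1 (HomologySequence.exact₂ _ hT 0)⟩

theorem singleδ_eq_of_distTriang {S : ShortComplex A} (hS : S.ShortExact)
    (h : (singleFunctor A 0).obj S.X₃ ⟶ ((singleFunctor A 0).obj S.X₁)⟦(1 : ℤ)⟧)
    (hT : Triangle.mk ((singleFunctor A 0).map S.f) ((singleFunctor A 0).map S.g) h ∈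
      distTriang (DerivedCategory A)) : hS.singleδ = h := by
  let F := singleFunctor A 0
  obtain ⟨c, hc₂, hc₃⟩ : ∃ c : F.obj S.X₃ ⟶ F.obj S.X₃,
      F.map S.g ≫ c = 𝟙 _ ≫ F.map S.g ∧ h ≫ (𝟙 (F.obj S.X₁))⟦(1 : ℤ)⟧' = c ≫ hS.singleδ :=
    complete_distinguished_triangle_morphism _ _ hT hS.singleTriangle_distinguished (𝟙 _) (𝟙 _)
      ((Category.comp_id _).trans (Category.id_comp _).symm)
  have hc : c = 𝟙 _ := by
    have := hS.epi_g
    obtain ⟨c, rfl⟩ := F.map_surjective c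
    have hc : c = 𝟙 _ := by
      rw [← cancel_epi S.g]
      exact F.map_injective (by simpa using hc₂)
    rw [hc, F.map_id]
  simpa [F, hc] using hc₃.symm

theorem exists_distTriang_single {X Y : A}
    (h : (singleFunctor A 0).obj X ⟶ ((singleFunctor A 0).obj Y)⟦(1 : ℤ)⟧) :
    ∃ (E : A) (i : Y ⟶ E) (p : E ⟶ X),
      Triangle.mk ((singleFunctor A 0).map i) ((singleFunctor A 0).map p) h ∈
        distTriang (DerivedCategory A) := by
  let F := singleFunctor A 0
  obtain ⟨T, i', p', hT⟩ := distinguished_cocone_triangle₂ h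
  have : T.IsGE 0 := TStructure.t.isGE₂ _ hT 0 (inferInstanceAs ((F.obj Y).IsGE 0))
    (inferInstanceAs ((F.obj X).IsGE 0))
  have : T.IsLE 0 := TStructure.t.isLE₂ _ hT 0 (inferInstanceAs ((F.obj Y).IsLE 0))
    (inferInstanceAs ((F.obj X).IsLE 0))
  obtain ⟨E, ⟨e⟩⟩ := exists_iso_singleFunctor_obj_of_isGE_of_isLE T 0
  refine ⟨E, F.preimage (i' ≫ e.hom), F.preimage (e.inv ≫ p'), ?_⟩
  exact isomorphic_distinguished _ hT _ (Triangle.isoMk _ _ (Iso.refl _) e.symm (Iso.refl _)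
    (show F.map _ ≫ e.inv = 𝟙 _ ≫ i' by simp)
    (show F.map _ ≫ 𝟙 _ = e.inv ≫ p' by simp)
    (show h ≫ (𝟙 (F.obj Y))⟦(1 : ℤ)⟧' = 𝟙 _ ≫ h by simp [F]))

end

theorem exists_extClass_eq [HasExt.{w} A] {X Y : A} (e : Ext.{w} X Y 1) :
    ∃ (E : A) (i : Y ⟶ E) (p : E ⟶ X) (hip : i ≫ p = 0)
      (hS : (ShortComplex.mk i p hip).ShortExact), hS.extClass = e := by
  let := HasDerivedCategory.standard A
  obtain ⟨E, i, p, hT⟩ := exists_distTriang_single e.hom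
  have hip : i ≫ p = 0 := by
    apply (singleFunctor A 0).map_injective
    rw [Functor.map_comp, Functor.map_zero]
    exact comp_distTriang_mor_zero₁₂ _ hT
  have hS := shortExact_of_distTriang_single (ShortComplex.mk i p hip) e.hom hT
  refine ⟨E, i, p, hip, hS, ?_⟩
  ext
  rw [hS.extClass_hom]
  exact singleδ_eq_of_distTriang hS e.hom hT

theorem exists_hom_of_extClass_comp_eq [HasExt.{w} A] {S T : ShortComplex A} (hS : S.ShortExact)
    (hT : T.ShortExact) (α : S.X₁ ⟶ T.X₁) (γ : S.X₃ ⟶ T.X₃)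
    (h : hS.extClass.comp (Ext.mk₀ α) (add_zero 1) =
      (Ext.mk₀ γ).comp hT.extClass (zero_add 1)) :
    ∃ φ : S ⟶ T, φ.τ₁ = α ∧ φ.τ₃ = γ := by
  have := hS.epi_g
  -- A map `u` on the middle terms extending `α` induces some `q` on the quotients, which need not
  -- be `γ`; but `q - γ` lifts to `T.X₂`, and `u` is corrected by such a lift.
  obtain ⟨u, hu⟩ : ∃ u : S.X₂ ⟶ T.X₂, S.f ≫ u = α ≫ T.f := by
    have hα : hS.extClass.comp (Ext.mk₀ (α ≫ T.f)) (add_zero 1) = 0 := by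
      rw [← Ext.mk₀_comp_mk₀, ← Ext.comp_assoc_of_third_deg_zero, h,
        Ext.comp_assoc_of_third_deg_zero, hT.extClass_comp, Ext.comp_zero]
    obtain ⟨u, hu⟩ := Ext.contravariant_sequence_exact₁ hS _ (Ext.mk₀ (α ≫ T.f)) rfl hα
    obtain ⟨u, rfl⟩ := (Ext.mk₀_bijective _ _).2 u
    exact ⟨u, (Ext.mk₀_bijective _ _).1 (by rwa [← Ext.mk₀_comp_mk₀])⟩
  let q : S.X₃ ⟶ T.X₃ := hS.exact.desc (u ≫ T.g) (by rw [reassoc_of% hu, T.zero, comp_zero])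
  have hq : S.g ≫ q = u ≫ T.g := hS.exact.g_desc _ _
  obtain ⟨w, hw⟩ : ∃ w : S.X₃ ⟶ T.X₂, w ≫ T.g = q - γ := by
    have hqγ : (Ext.mk₀ (q - γ)).comp hT.extClass (zero_add 1) = 0 := by
      have hnat : hS.extClass.comp (Ext.mk₀ α) (add_zero 1) =
          (Ext.mk₀ q).comp hT.extClass (zero_add 1) :=
        hS.extClass_naturality hT (ShortComplex.homMk α u q hu.symm hq.symm)
      have hadd : Ext.mk₀ q = Ext.mk₀ (q - γ) + Ext.mk₀ γ := by
        rw [← Ext.mk₀_add, sub_add_cancel]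
      rw [hadd, Ext.add_comp, h, right_eq_add] at hnat
      exact hnat
    obtain ⟨w, hw⟩ := Ext.covariant_sequence_exact₃ _ hT (Ext.mk₀ (q - γ)) rfl hqγ
    obtain ⟨w, rfl⟩ := (Ext.mk₀_bijective _ _).2 w
    exact ⟨w, (Ext.mk₀_bijective _ _).1 (by rwa [← Ext.mk₀_comp_mk₀])⟩
  exact ⟨ShortComplex.homMk α (u - S.g ≫ w) γ (by simp [hu]) (by simp [hq, hw]), rfl, rfl⟩

theorem shortExact_comp_cokernel {K X W E : A} {g : X ⟶ W} {i : K ⟶ X} (hi : i ≫ g = 0)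
    (hK : (ShortComplex.mk i g hi).Exact) [Mono i] {u : X ⟶ E} {p : E ⟶ W}
    (hp : (i ≫ u) ≫ p = 0) (hE : (ShortComplex.mk (i ≫ u) p hp).ShortExact) (hup : u ≫ p = g) :
    (ShortComplex.mk u (p ≫ cokernel.π g)
      (by rw [reassoc_of% hup, cokernel.condition])).ShortExact := by
  have : Mono (i ≫ u) := hE.mono_f
  have : Epi p := hE.epi_g
  have hu : Mono u := Preadditive.mono_of_cancel_zero _ fun x hx => by
    have hxi : hK.lift x (by simp [← hup, reassoc_of% hx]) ≫ i = x := hK.lift_f _ _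
    have hl := zero_of_comp_mono (i ≫ u) (by rw [reassoc_of% hxi, hx])
    rw [← hxi, hl, zero_comp]
  have : Epi (p ≫ cokernel.π g) := epi_comp _ _
  refine ⟨ShortComplex.exact_of_g_is_cokernel _
    (CokernelCofork.IsColimit.ofπ' _ _ fun {T} k hk => ?_)⟩
  let k' : W ⟶ T := hE.exact.desc k (by simp [hk])
  have hk' : p ≫ k' = k := hE.exact.g_desc _ _
  exact ⟨cokernel.desc g k' (by rw [← hup, Category.assoc, hk', hk]), by simp [hk']⟩

theorem IsHereditary.exists_mono_epi_factorization [IsHereditary A] {X W : A} (g : X ⟶ W) :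
    ∃ (E : A) (u : X ⟶ E) (p : E ⟶ W) (hup : u ≫ p = g),
      (ShortComplex.mk (kernel.ι g ≫ u) p (by simp [hup])).ShortExact ∧
      (ShortComplex.mk u (p ≫ cokernel.π g) (by simp [reassoc_of% hup])).ShortExact := by
  let := HasExt.standard A
  have hK : (ShortComplex.mk (kernel.ι g) (factorThruImage g)
      (by rw [← cancel_mono (image.ι g)]; simp)).ShortExact :=
    ⟨ShortComplex.exact_of_f_is_kernel _
      (isKernelOfComp _ _ (kernelIsKernel g) _ (image.fac g))⟩
  have hC : (ShortComplex.mk (image.ι g) (cokernel.π g) (by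
      rw [← cancel_epi (factorThruImage g)]; simp)).ShortExact :=
    ⟨ShortComplex.exact_of_g_is_cokernel _
      (isCokernelOfComp _ _ (cokernelIsCokernel g) _ (image.fac g))⟩
  obtain ⟨(e : Ext W (kernel g) 1), he⟩ := Ext.contravariant_sequence_exact₁ hC _ hK.extClass
    (n₁ := 2) rfl (IsHereditary.ext_eq_zero _ _ _ one_lt_two _)
  obtain ⟨E, i, p, hip, hE, rfl⟩ := exists_extClass_eq e
  obtain ⟨u, rfl, hup⟩ : ∃ u : X ⟶ E, kernel.ι g ≫ u = i ∧ u ≫ p = g := by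
    obtain ⟨φ, hφ₁, hφ₃⟩ := exists_hom_of_extClass_comp_eq hK hE (𝟙 _) (image.ι g)
      ((Ext.comp_mk₀_id _).trans he.symm)
    exact ⟨φ.τ₂, by simpa [hφ₁] using φ.comm₁₂.symm, by simpa [hφ₃] using φ.comm₂₃⟩
  exact ⟨E, u, p, hup, hE, shortExact_comp_cokernel _ (ShortComplex.exact_kernel g) hip hE hup⟩

end Extensions

section ThreeCycles

open ZeroObject

variable {A : Type u} [Category.{v} A] [Abelian A]

theorem quasiIso_g_of_acyclic_X₁ {ι : Type*} {c : ComplexShape ι}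
    {S : ShortComplex (HomologicalComplex A c)} (hS : S.ShortExact) (h : S.X₁.Acyclic) :
    QuasiIso S.g := by
  let T : ShortComplex (HomologicalComplex A c) := .mk (0 : 0 ⟶ S.X₂) (𝟙 S.X₂) zero_comp
  have hT : T.ShortExact :=
    { exact := (ShortComplex.exact_iff_mono _ rfl).2 (inferInstanceAs (Mono (𝟙 S.X₂)))
      mono_f := inferInstanceAs (Mono (0 : 0 ⟶ S.X₂))
      epi_g := inferInstanceAs (Epi (𝟙 S.X₂)) }
  let φ : T ⟶ S := ShortComplex.homMk 0 (𝟙 S.X₂) S.g (by simp [T]) (by simp [T])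
  refine HomologicalComplex.HomologySequence.quasiIso_τ₃ φ hT hS ⟨fun i => ?_⟩
    (inferInstanceAs (QuasiIso (𝟙 S.X₂)))
  exact (quasiIsoAt_iff_exactAt' _ i (h i)).2
    (HomologicalComplex.acyclic_of_isZero _ (isZero_zero _) i)

theorem zmod_three_forall {P : ZMod 3 → Prop} (h₁ : P 1) (h₂ : P 2) (h₃ : P 3) : ∀ i, P i := by
  change ∀ i : Fin 3, P i
  intro i
  fin_cases i
  exacts [h₃, h₁, h₂]

/-- The isomorphism of a complex indexed by `ℤ/3` with the 3-cycle complex given by its three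
differentials. -/
def threeCycleIso (X : CycleComplex A 3) :
    X ≅ threeCycle (X.d 1 2) (X.d 2 3) (X.d 3 1) (X.d_comp_d 1 2 3) (X.d_comp_d 2 3 1)
      (X.d_comp_d 3 1 2) :=
  HomologicalComplex.Hom.isoOfComponents
    (fun
      | (0 : Fin 3) => Iso.refl (X.X 3)
      | 1 => Iso.refl (X.X 1)
      | 2 => Iso.refl (X.X 2))
    (by
      rintro i _ rfl
      revert i
      exact zmod_three_forall ((Category.id_comp _).trans (Category.comp_id _).symm)
        ((Category.id_comp _).trans (Category.comp_id _).symm)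
        ((Category.id_comp _).trans (Category.comp_id _).symm))

variable {X₁ X₂ X₃ Y₁ Y₂ Y₃ : A}
  {f₁ : X₁ ⟶ X₂} {f₂ : X₂ ⟶ X₃} {f₃ : X₃ ⟶ X₁}
  {hf₁₂ : f₁ ≫ f₂ = 0} {hf₂₃ : f₂ ≫ f₃ = 0} {hf₃₁ : f₃ ≫ f₁ = 0}
  {g₁ : Y₁ ⟶ Y₂} {g₂ : Y₂ ⟶ Y₃} {g₃ : Y₃ ⟶ Y₁}
  {hg₁₂ : g₁ ≫ g₂ = 0} {hg₂₃ : g₂ ≫ g₃ = 0} {hg₃₁ : g₃ ≫ g₁ = 0}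

/-- The morphism of 3-cycle complexes given by its three components. -/
def threeCycleMap (φ₁ : X₁ ⟶ Y₁) (φ₂ : X₂ ⟶ Y₂) (φ₃ : X₃ ⟶ Y₃)
    (h₁ : φ₁ ≫ g₁ = f₁ ≫ φ₂) (h₂ : φ₂ ≫ g₂ = f₂ ≫ φ₃) (h₃ : φ₃ ≫ g₃ = f₃ ≫ φ₁) :
    threeCycle f₁ f₂ f₃ hf₁₂ hf₂₃ hf₃₁ ⟶ threeCycle g₁ g₂ g₃ hg₁₂ hg₂₃ hg₃₁ where
  f := fun
    | (0 : Fin 3) => φ₃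
    | 1 => φ₁
    | 2 => φ₂
  comm' := by
    rintro i _ rfl
    revert i
    exact zmod_three_forall h₁ h₂ h₃

/-- The isomorphism of 3-cycle complexes given by its three components. -/
def threeCycleMapIso (φ₁ : X₁ ≅ Y₁) (φ₂ : X₂ ≅ Y₂) (φ₃ : X₃ ≅ Y₃)
    (h₁ : φ₁.hom ≫ g₁ = f₁ ≫ φ₂.hom) (h₂ : φ₂.hom ≫ g₂ = f₂ ≫ φ₃.hom)
    (h₃ : φ₃.hom ≫ g₃ = f₃ ≫ φ₁.hom) :
    threeCycle f₁ f₂ f₃ hf₁₂ hf₂₃ hf₃₁ ≅ threeCycle g₁ g₂ g₃ hg₁₂ hg₂₃ hg₃₁ :=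
  HomologicalComplex.Hom.isoOfComponents
    (fun
      | (0 : Fin 3) => φ₃
      | 1 => φ₁
      | 2 => φ₂)
    (by
      rintro i _ rfl
      revert i
      exact zmod_three_forall h₁ h₂ h₃)

theorem acyclic_threeCycle_id (N : A) :
    (threeCycle (𝟙 N) (0 : N ⟶ 0) (0 : (0 : A) ⟶ N) comp_zero comp_zero zero_comp).Acyclic := by
  refine zmod_three_forall ?_ ?_ ?_
  · rw [HomologicalComplex.exactAt_iff' _ 3 1 2 (ComplexShape.prev_eq' _ rfl)
      (ComplexShape.next_eq' _ rfl)]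
    exact (ShortComplex.exact_iff_mono _ rfl).2 (inferInstanceAs (Mono (𝟙 N)))
  · rw [HomologicalComplex.exactAt_iff' _ 1 2 3 (ComplexShape.prev_eq' _ rfl)
      (ComplexShape.next_eq' _ rfl)]
    exact (ShortComplex.exact_iff_epi _ rfl).2 (inferInstanceAs (Epi (𝟙 N)))
  · exact .of_isZero (isZero_zero A)

-- The kernel of such a morphism is the acyclic complex `N ⟶ N ⟶ 0 ⟶ N` whose first map is `𝟙 N`.
theorem quasiIso_threeCycleMap (φ₁ : X₁ ⟶ Y₁) (φ₂ : X₂ ⟶ Y₂) (φ₃ : X₃ ⟶ Y₃)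
    (h₁ : φ₁ ≫ g₁ = f₁ ≫ φ₂) (h₂ : φ₂ ≫ g₂ = f₂ ≫ φ₃) (h₃ : φ₃ ≫ g₃ = f₃ ≫ φ₁)
    {N : A} (k : N ⟶ X₁) (hk₁ : k ≫ φ₁ = 0) (hk₂ : (k ≫ f₁) ≫ φ₂ = 0)
    (H₁ : (ShortComplex.mk k φ₁ hk₁).ShortExact)
    (H₂ : (ShortComplex.mk (k ≫ f₁) φ₂ hk₂).ShortExact) [IsIso φ₃] :
    QuasiIso (threeCycleMap φ₁ φ₂ φ₃ h₁ h₂ h₃ :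
      threeCycle f₁ f₂ f₃ hf₁₂ hf₂₃ hf₃₁ ⟶ threeCycle g₁ g₂ g₃ hg₁₂ hg₂₃ hg₃₁) := by
  let κ : threeCycle (𝟙 N) (0 : N ⟶ 0) (0 : (0 : A) ⟶ N) comp_zero comp_zero zero_comp ⟶
      threeCycle f₁ f₂ f₃ hf₁₂ hf₂₃ hf₃₁ :=
    threeCycleMap k (k ≫ f₁) 0 (Category.id_comp _).symm (by simp [hf₁₂]) (by simp)
  have hκ : κ ≫ (threeCycleMap φ₁ φ₂ φ₃ h₁ h₂ h₃ : _ ⟶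
      threeCycle g₁ g₂ g₃ hg₁₂ hg₂₃ hg₃₁) = 0 :=
    HomologicalComplex.hom_ext _ _ (zmod_three_forall hk₁ hk₂ zero_comp)
  have H₃ : (ShortComplex.mk (0 : (0 : A) ⟶ X₃) φ₃ zero_comp).ShortExact :=
    { exact := (ShortComplex.exact_iff_mono _ rfl).2 (inferInstanceAs (Mono φ₃))
      mono_f := inferInstanceAs (Mono (0 : (0 : A) ⟶ X₃))
      epi_g := inferInstanceAs (Epi φ₃) }
  exact quasiIso_g_of_acyclic_X₁ (HomologicalComplex.shortExact_of_degreewise_shortExact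
    (ShortComplex.mk κ _ hκ) (zmod_three_forall H₁ H₂ H₃)) (acyclic_threeCycle_id N)

end ThreeCycles

section Rotation

variable (A : Type u) [Category.{v} A] [Abelian A] (t : ℕ)

/-- The rotation of `C_t(A)`: the translation functor without the sign, so that it carries
`X₁ ⟶ X₂ ⟶ X₃ ⟶ X₁` to `X₂ ⟶ X₃ ⟶ X₁ ⟶ X₂`. The translation functor could not be used for that:
changing the sign of all three differentials in general changes the isomorphism class of the
complex. -/
def CycleComplex.rotate : CycleComplex A t ⥤ CycleComplex A t where
  obj X :=
    { X := fun i => X.X (i + 1)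
      d := fun i j => X.d (i + 1) (j + 1)
      shape := fun i j hij => X.shape _ _ fun h =>
        hij (add_right_cancel (show i + 1 + 1 = j + 1 from h))
      d_comp_d' := fun i j k _ _ => X.d_comp_d _ _ _ }
  map φ :=
    { f := fun i => φ.f (i + 1)
      comm' := fun i j _ => φ.comm _ _ }

variable {A t}

theorem CycleComplex.quasiIso_rotate_map {X Y : CycleComplex A t} (φ : X ⟶ Y) [QuasiIso φ] :
    QuasiIso ((CycleComplex.rotate A t).map φ) where
  quasiIsoAt i := by
    rw [quasiIsoAt_iff' _ (i - 1) i (i + 1) (ComplexShape.prev_eq' _ (sub_add_cancel i 1))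
      (ComplexShape.next_eq' _ rfl)]
    exact (quasiIsoAt_iff' φ (i - 1 + 1) (i + 1) (i + 1 + 1)
      (ComplexShape.prev_eq' _ (congrArg (· + 1) (sub_add_cancel i 1)))
      (ComplexShape.next_eq' _ rfl)).1 inferInstance

/-- Two cycle complexes are joined by a roof `X ⟵ Z ⟶ Y` of quasi-isomorphisms. Such roofs, unlike
isomorphisms in the derived category, can be rotated without first extending the rotation to the
derived category. -/
def CycleComplex.Roof (X Y : CycleComplex A t) : Prop :=
  ∃ (Z : CycleComplex A t) (α : Z ⟶ X) (β : Z ⟶ Y), QuasiIso α ∧ QuasiIso β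

theorem CycleComplex.Roof.rotate {X Y : CycleComplex A t} (h : Roof X Y) :
    Roof ((CycleComplex.rotate A t).obj X) ((CycleComplex.rotate A t).obj Y) := by
  obtain ⟨Z, α, β, _, _⟩ := h
  exact ⟨_, _, _, quasiIso_rotate_map α, quasiIso_rotate_map β⟩

theorem CycleComplex.Roof.of_iso {X Y X' Y' : CycleComplex A t} (h : Roof X Y) (e : X ≅ X')
    (e' : Y ≅ Y') : Roof X' Y' := by
  obtain ⟨Z, α, β, _, _⟩ := h
  exact ⟨Z, α ≫ e.hom, β ≫ e'.hom, inferInstance, inferInstance⟩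

theorem CycleDerivedCategory.isIso_Q_map {X Y : CycleComplex A t} (φ : X ⟶ Y) [QuasiIso φ] :
    IsIso ((CycleDerivedCategory.Q A t).map φ) :=
  MorphismProperty.Q_inverts _ _
    ((HomotopyCategory.quotient_map_mem_quasiIso_iff φ).2 ‹QuasiIso φ›)

theorem CycleComplex.Roof.nonempty_iso {X Y : CycleComplex A t} (h : Roof X Y) :
    Nonempty ((CycleDerivedCategory.Q A t).obj X ≅ (CycleDerivedCategory.Q A t).obj Y) := by
  obtain ⟨Z, α, β, _, _⟩ := h
  have := CycleDerivedCategory.isIso_Q_map α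
  have := CycleDerivedCategory.isIso_Q_map β
  exact ⟨(asIso ((CycleDerivedCategory.Q A t).map α)).symm ≪≫
    asIso ((CycleDerivedCategory.Q A t).map β)⟩

theorem CycleComplex.Roof.threeCycle_rotate {X₁ X₂ X₃ Y₁ Y₂ Y₃ : A}
    {f₁ : X₁ ⟶ X₂} {f₂ : X₂ ⟶ X₃} {f₃ : X₃ ⟶ X₁}
    {hf₁₂ : f₁ ≫ f₂ = 0} {hf₂₃ : f₂ ≫ f₃ = 0} {hf₃₁ : f₃ ≫ f₁ = 0}
    {g₁ : Y₁ ⟶ Y₂} {g₂ : Y₂ ⟶ Y₃} {g₃ : Y₃ ⟶ Y₁}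
    {hg₁₂ : g₁ ≫ g₂ = 0} {hg₂₃ : g₂ ≫ g₃ = 0} {hg₃₁ : g₃ ≫ g₁ = 0}
    (h : Roof (threeCycle f₁ f₂ f₃ hf₁₂ hf₂₃ hf₃₁) (threeCycle g₁ g₂ g₃ hg₁₂ hg₂₃ hg₃₁)) :
    Roof (threeCycle f₂ f₃ f₁ hf₂₃ hf₃₁ hf₁₂) (threeCycle g₂ g₃ g₁ hg₂₃ hg₃₁ hg₁₂) :=
  h.rotate.of_iso (threeCycleIso _) (threeCycleIso _)

end Rotation

section Splitting

variable {A : Type u} [Category.{v} A] [Abelian A] {X₁ X₂ X₃ : A}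
  {f₁ : X₁ ⟶ X₂} {f₂ : X₂ ⟶ X₃} {f₃ : X₃ ⟶ X₁}

theorem desc_comp_kernel_lift (h₁₂ : f₁ ≫ f₂ = 0) (h₂₃ : f₂ ≫ f₃ = 0) (h₃₁ : f₃ ≫ f₁ = 0) :
    cokernel.desc f₁ f₂ h₁₂ ≫ kernel.lift f₁ f₃ h₃₁ = 0 := by
  rw [← cancel_epi (cokernel.π f₁), ← cancel_mono (kernel.ι f₁)]
  simp [h₂₃]

/-- The 3-cycle complex obtained by replacing `f₁` by the zero map from its kernel to its
cokernel. -/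
noncomputable abbrev kerCokerCycle (h₁₂ : f₁ ≫ f₂ = 0) (h₂₃ : f₂ ≫ f₃ = 0) (h₃₁ : f₃ ≫ f₁ = 0) :
    CycleComplex A 3 :=
  threeCycle (0 : kernel f₁ ⟶ cokernel f₁) (cokernel.desc f₁ f₂ h₁₂) (kernel.lift f₁ f₃ h₃₁)
    zero_comp (desc_comp_kernel_lift h₁₂ h₂₃ h₃₁) comp_zero

variable (h₁₂ : f₁ ≫ f₂ = 0) (h₂₃ : f₂ ≫ f₃ = 0) (h₃₁ : f₃ ≫ f₁ = 0)

section

variable {E : A} {u : X₁ ⟶ E} {p : E ⟶ X₂} (hup : u ≫ p = f₁)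

include hup in
theorem biprod_desc_comp_eq :
    biprod.desc u (kernel.ι f₁ ≫ u) ≫ p = biprod.fst ≫ f₁ := by
  ext <;> simp [hup]

/-- The 3-cycle complex `X₁ ⊞ Ker f₁ ⟶ E ⟶ X₃ ⟶ X₁ ⊞ Ker f₁` attached to a factorization
`X₁ ⟶ E ⟶ X₂` of `f₁`. -/
noncomputable def factorizationCycle : CycleComplex A 3 :=
  threeCycle (biprod.desc u (kernel.ι f₁ ≫ u)) (p ≫ f₂)
    (biprod.lift f₃ (-kernel.lift f₁ f₃ h₃₁))
    (by rw [reassoc_of% biprod_desc_comp_eq hup, h₁₂, comp_zero])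
    (by
      have : f₂ ≫ kernel.lift f₁ f₃ h₃₁ = 0 := by simp [← cancel_mono (kernel.ι f₁), h₂₃]
      ext <;> simp [h₂₃, this])
    (by simp)

/-- The projection of `factorizationCycle` onto the original complex. -/
noncomputable def factorizationCycle.toCycle :
    factorizationCycle h₁₂ h₂₃ h₃₁ hup ⟶ threeCycle f₁ f₂ f₃ h₁₂ h₂₃ h₃₁ :=
  threeCycleMap biprod.fst p (𝟙 X₃) (biprod_desc_comp_eq hup).symm (Category.comp_id _).symm
    (by simp)

/-- The projection of `factorizationCycle` onto the complex with `f₁` replaced by zero. -/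
noncomputable def factorizationCycle.toKerCokerCycle :
    factorizationCycle h₁₂ h₂₃ h₃₁ hup ⟶ kerCokerCycle h₁₂ h₂₃ h₃₁ :=
  threeCycleMap (-biprod.snd) (p ≫ cokernel.π f₁) (𝟙 X₃)
    (by rw [comp_zero, reassoc_of% biprod_desc_comp_eq hup, cokernel.condition, comp_zero])
    (by simp) (by simp)

theorem factorizationCycle.quasiIso_toCycle
    (h : (ShortComplex.mk (kernel.ι f₁ ≫ u) p (by simp [hup])).ShortExact) :
    QuasiIso (factorizationCycle.toCycle h₁₂ h₂₃ h₃₁ hup) := by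
  refine quasiIso_threeCycleMap _ _ _ _ _ _ (k := biprod.inr) biprod.inr_fst
    (by simp [hup]) ?_ (by simpa using h)
  exact ShortComplex.Splitting.shortExact
    { r := biprod.snd, s := biprod.inl, id := (add_comm _ _).trans biprod.total }

theorem factorizationCycle.quasiIso_toKerCokerCycle
    (h : (ShortComplex.mk u (p ≫ cokernel.π f₁) (by simp [reassoc_of% hup])).ShortExact) :
    QuasiIso (factorizationCycle.toKerCokerCycle h₁₂ h₂₃ h₃₁ hup) := by
  refine quasiIso_threeCycleMap _ _ _ _ _ _ (k := biprod.inl) (by simp)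
    (by simp [reassoc_of% hup]) ?_ (by simpa using h)
  exact ShortComplex.Splitting.shortExact { r := biprod.fst, s := -biprod.inr }

end

theorem roof_kerCokerCycle [IsHereditary A] :
    CycleComplex.Roof (threeCycle f₁ f₂ f₃ h₁₂ h₂₃ h₃₁) (kerCokerCycle h₁₂ h₂₃ h₃₁) := by
  obtain ⟨E, u, p, hup, hker, hcoker⟩ := IsHereditary.exists_mono_epi_factorization f₁
  exact ⟨_, _, _, factorizationCycle.quasiIso_toCycle h₁₂ h₂₃ h₃₁ hup hker,
    factorizationCycle.quasiIso_toKerCokerCycle h₁₂ h₂₃ h₃₁ hup hcoker⟩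

end Splitting

section Homology

variable {A : Type u} [Category.{v} A] [Abelian A] {X Y Z : A} (f : X ⟶ Y) (g : Y ⟶ Z)
  (h : f ≫ g = 0)

theorem nonempty_kernel_cokernelDesc_iso_kerModIm :
    Nonempty (kernel (cokernel.desc f g h) ≅ kerModIm f g h) := by
  let S := ShortComplex.mk f g h
  have hι : image.ι f ≫ g = 0 := by
    rw [← cancel_epi (factorThruImage f), image.fac_assoc, h, comp_zero]
  have hf : factorThruImage f ≫ kernel.lift g (image.ι f) hι = kernel.lift g f h := by
    simp [← cancel_mono (kernel.ι g)]
  let l : S.LeftHomologyData :=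
    { K := kernel g
      H := kerModIm f g h
      i := kernel.ι g
      π := cokernel.π (kernel.lift g (image.ι f) hι)
      wi := kernel.condition g
      hi := kernelIsKernel g
      wπ := by
        change kernel.lift g f h ≫ cokernel.π (kernel.lift g (image.ι f) hι) = 0
        rw [← hf, Category.assoc, cokernel.condition, comp_zero]
      hπ := isCokernelEpiComp (cokernelIsCokernel (kernel.lift g (image.ι f) hι))
        (factorThruImage f) hf.symm }
  let r : S.RightHomologyData :=
    { Q := cokernel f
      H := kernel (cokernel.desc f g h)
      p := cokernel.π f
      ι := kernel.ι _
      wp := cokernel.condition f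
      hp := cokernelIsCokernel f
      wι := kernel.condition _
      hι := kernelIsKernel _ }
  exact ⟨r.homologyIso.symm ≪≫ l.homologyIso⟩

/-- The cokernel of the map `Coker f ⟶ Z` induced by `g` is the cokernel of `g`. -/
noncomputable def cokernelCokernelDescIso : cokernel (cokernel.desc f g h) ≅ cokernel g :=
  (cokernelEpiComp (cokernel.π f) _).symm ≪≫ cokernelIsoOfEq (cokernel.π_desc f g h)

theorem π_cokernelCokernelDescIso_hom :
    cokernel.π (cokernel.desc f g h) ≫ (cokernelCokernelDescIso f g h).hom = cokernel.π g := by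
  simp [cokernelCokernelDescIso]

end Homology

section FirstIso

variable {A : Type u} [Category.{v} A] [Abelian A] [IsHereditary A] {X₁ X₂ X₃ : A}
  (f₁ : X₁ ⟶ X₂) (f₂ : X₂ ⟶ X₃) (f₃ : X₃ ⟶ X₁)
  (h₁₂ : f₁ ≫ f₂ = 0) (h₂₃ : f₂ ≫ f₃ = 0) (h₃₁ : f₃ ≫ f₁ = 0)

theorem nonempty_iso_threeCycle_cokerToKer :
    Nonempty ((CycleDerivedCategory.Q A 3).obj (threeCycle f₁ f₂ f₃ h₁₂ h₂₃ h₃₁) ≅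
      (CycleDerivedCategory.Q A 3).obj
        (threeCycle (0 : kernel f₁ ⟶ kerModIm f₁ f₂ h₁₂) (0 : kerModIm f₁ f₂ h₁₂ ⟶ cokernel f₂)
          (cokerToKer f₁ f₂ f₃ h₂₃ h₃₁) comp_zero zero_comp comp_zero)) := by
  obtain ⟨e₁⟩ := (roof_kerCokerCycle h₁₂ h₂₃ h₃₁).nonempty_iso
  obtain ⟨e₂⟩ := (roof_kerCokerCycle (desc_comp_kernel_lift h₁₂ h₂₃ h₃₁) comp_zero
    zero_comp).threeCycle_rotate.threeCycle_rotate.nonempty_iso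
  obtain ⟨e⟩ := nonempty_kernel_cokernelDesc_iso_kerModIm f₁ f₂ h₁₂
  refine ⟨e₁ ≪≫ e₂ ≪≫ (CycleDerivedCategory.Q A 3).mapIso
    (threeCycleMapIso (Iso.refl _) e (cokernelCokernelDescIso f₁ f₂ h₁₂) ?_ ?_ ?_)⟩
  · simp
  · simp
  · rw [← cancel_epi (cokernel.π (cokernel.desc f₁ f₂ h₁₂)),
      reassoc_of% π_cokernelCokernelDescIso_hom]
    simp [cokerToKer]

end FirstIso

section DirectSumsOfStalks

open ZeroObject

variable {A : Type u} [Category.{v} A] [Abelian A]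

theorem CycleDerivedCategory.nonempty_Q_obj_biprod_iso (t : ℕ) (X Y : CycleComplex A t) :
    Nonempty ((CycleDerivedCategory.Q A t).obj (X ⊞ Y) ≅
      (CycleDerivedCategory.Q A t).obj X ⊞ (CycleDerivedCategory.Q A t).obj Y) := by
  have : HasBinaryBiproducts (CycleHomotopyCategory A t) := .of_hasBinaryProducts
  have : PreservesBinaryBiproducts (CycleHomotopyCategory.quotient A t) :=
    preservesBinaryBiproducts_of_preservesBiproducts _
  have : PreservesBinaryBiproduct ((CycleHomotopyCategory.quotient A t).obj X)
      ((CycleHomotopyCategory.quotient A t).obj Y) (CycleDerivedCategory.Qh A t) :=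
    ⟨fun {b} hb => ⟨
      { isLimit := mapIsLimitOfPreservesOfIsLimit (CycleDerivedCategory.Qh A t) _ _ hb.isLimit
        isColimit :=
          mapIsColimitOfPreservesOfIsColimit (CycleDerivedCategory.Qh A t) _ _ hb.isColimit }⟩⟩
  exact ⟨(CycleDerivedCategory.Qh A t).mapIso
    ((CycleHomotopyCategory.quotient A t).mapBiprod X Y) ≪≫
    (CycleDerivedCategory.Qh A t).mapBiprod _ _⟩

/-- The 3-cycle complex with zero differentials. -/
abbrev zeroCycle (M₁ M₂ M₃ : A) : CycleComplex A 3 :=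
  threeCycle (0 : M₁ ⟶ M₂) (0 : M₂ ⟶ M₃) (0 : M₃ ⟶ M₁) comp_zero comp_zero comp_zero

theorem zeroCycle_d (M₁ M₂ M₃ : A) : ∀ i j : ZMod 3, (zeroCycle M₁ M₂ M₃).d i j = 0 :=
  zmod_three_forall (zmod_three_forall rfl rfl rfl) (zmod_three_forall rfl rfl rfl)
    (zmod_three_forall rfl rfl rfl)

/-- A 3-cycle complex whose differentials vanish is determined by its terms. -/
def isoZeroCycle (X : CycleComplex A 3) (hX : ∀ i j, X.d i j = 0) {M₁ M₂ M₃ : A}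
    (e₁ : X.X 1 ≅ M₁) (e₂ : X.X 2 ≅ M₂) (e₃ : X.X 3 ≅ M₃) : X ≅ zeroCycle M₁ M₂ M₃ :=
  threeCycleIso X ≪≫ threeCycleMapIso e₁ e₂ e₃ (by simp [hX]) (by simp [hX]) (by simp [hX])

/-- The biproduct of 3-cycle complexes with zero differentials, taken termwise. -/
noncomputable def zeroCycleBicone (M₁ M₂ M₃ N₁ N₂ N₃ : A) :
    BinaryBicone (zeroCycle M₁ M₂ M₃) (zeroCycle N₁ N₂ N₃) where
  pt := zeroCycle (M₁ ⊞ N₁) (M₂ ⊞ N₂) (M₃ ⊞ N₃)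
  fst := threeCycleMap biprod.fst biprod.fst biprod.fst (by simp) (by simp) (by simp)
  snd := threeCycleMap biprod.snd biprod.snd biprod.snd (by simp) (by simp) (by simp)
  inl := threeCycleMap biprod.inl biprod.inl biprod.inl (by simp) (by simp) (by simp)
  inr := threeCycleMap biprod.inr biprod.inr biprod.inr (by simp) (by simp) (by simp)
  inl_fst := HomologicalComplex.hom_ext _ _
    (zmod_three_forall biprod.inl_fst biprod.inl_fst biprod.inl_fst)
  inl_snd := HomologicalComplex.hom_ext _ _
    (zmod_three_forall biprod.inl_snd biprod.inl_snd biprod.inl_snd)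
  inr_fst := HomologicalComplex.hom_ext _ _
    (zmod_three_forall biprod.inr_fst biprod.inr_fst biprod.inr_fst)
  inr_snd := HomologicalComplex.hom_ext _ _
    (zmod_three_forall biprod.inr_snd biprod.inr_snd biprod.inr_snd)

/-- The identification of `zeroCycleBicone` with the chosen biproduct. -/
noncomputable def zeroCycleBiprodIso (M₁ M₂ M₃ N₁ N₂ N₃ : A) :
    zeroCycle (M₁ ⊞ N₁) (M₂ ⊞ N₂) (M₃ ⊞ N₃) ≅ zeroCycle M₁ M₂ M₃ ⊞ zeroCycle N₁ N₂ N₃ :=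
  biprod.uniqueUpToIso _ _ (isBinaryBilimitOfTotal (zeroCycleBicone M₁ M₂ M₃ N₁ N₂ N₃)
    (HomologicalComplex.hom_ext _ _
      (zmod_three_forall biprod.total biprod.total biprod.total)))

/-- In `D_3(A)`, the stalk of `M` is `M ⟶ 0 ⟶ 0 ⟶ M`. -/
noncomputable def stalkIso (M : A) :
    stalk M ≅ (CycleDerivedCategory.Q A 3).obj (zeroCycle M 0 0) :=
  (CycleDerivedCategory.Q A 3).mapIso (isoZeroCycle
    ((HomologicalComplex.single A (ComplexShape.up (ZMod 3)) 1).obj M)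
    (HomologicalComplex.single_obj_d _ _ _)
    (HomologicalComplex.singleObjXSelf _ _ _)
    (HomologicalComplex.isZero_single_obj_X _ _ _ _ (by decide)).isoZero
    (HomologicalComplex.isZero_single_obj_X _ _ _ _ (by decide)).isoZero)

/-- The translation functor permutes the terms of a 3-cycle complex with zero differentials
cyclically. -/
noncomputable def shiftZeroCycleIso (M₁ M₂ M₃ : A) :
    (CycleDerivedCategory.shift A 3).obj
        ((CycleDerivedCategory.Q A 3).obj (zeroCycle M₁ M₂ M₃)) ≅
      (CycleDerivedCategory.Q A 3).obj (zeroCycle M₂ M₃ M₁) :=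
  (CycleDerivedCategory.Q A 3).mapIso (isoZeroCycle
    ((CycleComplex.shift A 3).obj (zeroCycle M₁ M₂ M₃))
    (fun i j => (congrArg Neg.neg (zeroCycle_d M₁ M₂ M₃ (i + 1) (j + 1))).trans neg_zero)
    (Iso.refl M₂) (Iso.refl M₃) (Iso.refl M₁))

/-- In `D_3(A)`, the object `M[1]` is `0 ⟶ 0 ⟶ M ⟶ 0`. -/
noncomputable def shiftStalkIso (M : A) :
    (CycleDerivedCategory.shift A 3).obj (stalk M) ≅
      (CycleDerivedCategory.Q A 3).obj (zeroCycle 0 0 M) :=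
  (CycleDerivedCategory.shift A 3).mapIso (stalkIso M) ≪≫ shiftZeroCycleIso M 0 0

/-- In `D_3(A)`, the object `M[2]` is `0 ⟶ M ⟶ 0 ⟶ 0`. -/
noncomputable def shiftShiftStalkIso (M : A) :
    (CycleDerivedCategory.shift A 3).obj ((CycleDerivedCategory.shift A 3).obj (stalk M)) ≅
      (CycleDerivedCategory.Q A 3).obj (zeroCycle 0 M 0) :=
  (CycleDerivedCategory.shift A 3).mapIso (shiftStalkIso M) ≪≫ shiftZeroCycleIso 0 0 M

theorem nonempty_zeroCycle_iso_biprod_stalk (M₁ M₂ M₃ : A) :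
    Nonempty ((CycleDerivedCategory.Q A 3).obj (zeroCycle M₁ M₂ M₃) ≅
      (CycleDerivedCategory.shift A 3).obj ((CycleDerivedCategory.shift A 3).obj (stalk M₂)) ⊞
        (CycleDerivedCategory.shift A 3).obj (stalk M₃) ⊞ stalk M₁) := by
  have zero_biprod (N : A) : N ≅ (0 : A) ⊞ N := isoZeroBiprod (isZero_zero A)
  have biprod_zero (N : A) : N ≅ N ⊞ (0 : A) := isoBiprodZero (isZero_zero A)
  have split₂ : zeroCycle M₁ M₂ M₃ ≅ zeroCycle 0 M₂ 0 ⊞ zeroCycle M₁ 0 M₃ :=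
    threeCycleMapIso (zero_biprod M₁) (biprod_zero M₂) (zero_biprod M₃)
      (by simp) (by simp) (by simp) ≪≫ zeroCycleBiprodIso _ _ _ _ _ _
  have split₃ : zeroCycle M₁ 0 M₃ ≅ zeroCycle 0 0 M₃ ⊞ zeroCycle M₁ 0 0 :=
    threeCycleMapIso (zero_biprod M₁) (zero_biprod 0) (biprod_zero M₃)
      (by simp) (by simp) (by simp) ≪≫ zeroCycleBiprodIso _ _ _ _ _ _
  obtain ⟨e₂⟩ := CycleDerivedCategory.nonempty_Q_obj_biprod_iso 3
    (zeroCycle 0 M₂ 0) (zeroCycle M₁ 0 M₃)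
  obtain ⟨e₃⟩ := CycleDerivedCategory.nonempty_Q_obj_biprod_iso 3
    (zeroCycle 0 0 M₃) (zeroCycle M₁ 0 0)
  exact ⟨(CycleDerivedCategory.Q A 3).mapIso split₂ ≪≫ e₂ ≪≫
    biprod.mapIso (shiftShiftStalkIso M₂).symm
      ((CycleDerivedCategory.Q A 3).mapIso split₃ ≪≫ e₃ ≪≫
        biprod.mapIso (shiftStalkIso M₃).symm (stalkIso M₁).symm)⟩

theorem nonempty_iso_biprod_stalk [IsHereditary A] {K H C : A} (f : C ⟶ K) :
    Nonempty ((CycleDerivedCategory.Q A 3).obj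
        (threeCycle (0 : K ⟶ H) (0 : H ⟶ C) f comp_zero zero_comp comp_zero) ≅
      (CycleDerivedCategory.shift A 3).obj ((CycleDerivedCategory.shift A 3).obj (stalk H)) ⊞
        (CycleDerivedCategory.shift A 3).obj (stalk (kernel f)) ⊞ stalk (cokernel f)) := by
  obtain ⟨e⟩ := (roof_kerCokerCycle (f₁ := f) (f₂ := (0 : K ⟶ H)) (f₃ := (0 : H ⟶ C))
    comp_zero comp_zero zero_comp).threeCycle_rotate.nonempty_iso
  obtain ⟨e'⟩ := nonempty_zeroCycle_iso_biprod_stalk (cokernel f) H (kernel f)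
  exact ⟨e ≪≫ (CycleDerivedCategory.Q A 3).mapIso (threeCycleMapIso (Iso.refl _) (Iso.refl _)
    (Iso.refl _) (by simp) (by simp) (by simp)) ≪≫ e'⟩

end DirectSumsOfStalks

theorem proposition3p2 {A : Type u} [Category.{v} A] [Abelian A] [IsHereditary A]
    (X : CycleComplex A 3) :
    let f₁ : X.X 1 ⟶ X.X 2 := X.d 1 2
    let f₂ : X.X 2 ⟶ X.X 3 := X.d 2 3
    let f₃ : X.X 3 ⟶ X.X 1 := X.d 3 1
    have h₁₂ : f₁ ≫ f₂ = 0 := X.d_comp_d 1 2 3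
    have h₂₃ : f₂ ≫ f₃ = 0 := X.d_comp_d 2 3 1
    have h₃₁ : f₃ ≫ f₁ = 0 := X.d_comp_d 3 1 2
    let f : cokernel f₂ ⟶ kernel f₁ := cokerToKer f₁ f₂ f₃ h₂₃ h₃₁
    Nonempty ((CycleDerivedCategory.Q A 3).obj X ≅
      (CycleDerivedCategory.Q A 3).obj
        (threeCycle (0 : kernel f₁ ⟶ kerModIm f₁ f₂ h₁₂) (0 : kerModIm f₁ f₂ h₁₂ ⟶ cokernel f₂) f
          comp_zero zero_comp comp_zero)) ∧
    Nonempty ((CycleDerivedCategory.Q A 3).obj X ≅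
      (CycleDerivedCategory.shift A 3).obj
          ((CycleDerivedCategory.shift A 3).obj (stalk (kerModIm f₁ f₂ h₁₂))) ⊞
        (CycleDerivedCategory.shift A 3).obj (stalk (kernel f)) ⊞
        stalk (cokernel f)) := by
  intro f₁ f₂ f₃ h₁₂ h₂₃ h₃₁ f
  obtain ⟨e⟩ := nonempty_iso_threeCycle_cokerToKer f₁ f₂ f₃ h₁₂ h₂₃ h₃₁
  obtain ⟨e'⟩ := nonempty_iso_biprod_stalk (H := kerModIm f₁ f₂ h₁₂) f
  let i := (CycleDerivedCategory.Q A 3).mapIso (threeCycleIso X) ≪≫ e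
  exact ⟨⟨i⟩, ⟨i ≪≫ e'⟩⟩
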